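/- Let $K$ be a field and let $q\in K$ be nonzero and not a root of unity (for example $q$ an indeterminate, or $q\in\mathbb C$ with $0<|q|<1$). For $a\in K$ put $(a)_n=\prod_{k=0}^{n-1}(1-aq^k)$ for integers $n\ge 0$ and $(a)_n=\prod_{k=1}^{-n}(1-aq^{-k})^{-1}$ for integers $n<0$, with the convention that the reciprocal $1/(a)_n$ is $\prod_{k=1}^{-n}(1-aq^{-k})$ when $n<0$; in particular $1/(q)_n=0$ for $n<0$. For integers $m,n$ let $\left[{n\atop m}\right]=\frac{(q)_n}{(q)_m(q)_{n-m}}$ if $0\le m\le n$ and $\left[{n\atop m}\right]=0$ otherwise. For integers $M_1,M_2,\lambda_1,\lambda_2,\lambda_3$ the A$_2$ supernomial is $$\left[{M_1,M_2\atop \lambda_1,\lambda_2,\lambda_3}\right]=\sum_{m\in\mathbb Z}\left[{\lambda_1-\lambda_2+2m\atop m}\right]\left[{M_1\atop \lambda_1-M_2+m}\right]\left[{M_2\atop \lambda_2-m}\right]$$ if $\lambda_1+\lambda_2+\lambda_3=M_1+2M_2$, and zero otherwise. **Proposition.** Let $L_1,L_2,\ell$ be integers such that $2L_1-L_2+\ell\ge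 0$, $2L_2-L_1\ge 0$ and $\ell\ge 0$. Then $(q^{-\ell})_{-L_1}$ is well defined and nonzero, and $$\sum_{\substack{k_1,k_2,k_3\in\mathbb Z\\ k_1+k_2+k_3=0}}\ \sum_{\sigma\in S_3}\epsilon(\sigma)\,q^{\frac12\sum_{s=1}^3(3k_s-2\sigma_s)k_s}\left[{2L_1-L_2+\ell,\;2L_2-L_1\atop L_2-3k_1+\sigma_1-1+\ell,\;L_2-3k_2+\sigma_2-2,\;L_2-3k_3+\sigma_3-3}\right]=\frac{q^{L_1^2-L_1L_2+L_2^2+\ell L_1}\,(q)_\ell}{(q^{-\ell})_{-L_1}\,(q)_{-L_2}},$$ where $S_3$ is the group of permutations of $1,2,3$, $\epsilon(\sigma)$ is the sign of $\sigma$, and only finitely many terms on the left are nonzero. If moreover $L_1,L_2\ge 0$, then the right-hand side equals $(q)_\ell\,\delta_{L_1,0}\,\delta_{L_2,0}$. -/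

import Mathlib

/-- The `q`-shifted factorial `(a; q)_n` for every integer `n`, that is `(a)_∞ / (a q ^ n)_∞` after
cancellation of the common factors: `∏_{0 ≤ k < n} (1 - a q ^ k)` for `n ≥ 0`, and
`1 / ∏_{1 ≤ k ≤ -n} (1 - a q ^ (-k))` for `n < 0`. If a factor of the latter product vanishes, the
symbol is infinite and its reciprocal is `0`; in Lean both then have the value `0`, so that the
reciprocal is the right one (see `qShifted_self_inv_of_neg`). -/
def qShifted {K : Type*} [Field K] (a q : K) (n : ℤ) : K :=
  if 0 ≤ n then ∏ k ∈ Finset.range n.toNat, (1 - a * q ^ k)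
  else (∏ k ∈ Finset.Icc 1 (-n).toNat, (1 - a * q ^ (-(k : ℤ))))⁻¹

/-- The convention `1 / (q)_n = 0` for `n < 0`. -/
theorem qShifted_self_inv_of_neg {K : Type*} [Field K] {q : K} (hq : q ≠ 0) {n : ℤ} (hn : n < 0) :
    (qShifted q q n)⁻¹ = 0 := by
  rw [qShifted, if_neg (by omega), inv_inv]
  refine Finset.prod_eq_zero (i := 1) (Finset.mem_Icc.2 ⟨le_rfl, by omega⟩) ?_
  simp [hq]

/-- The Gaussian polynomial (`q`-binomial coefficient), zero unless `0 ≤ m ≤ n`. -/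
def qBin {K : Type*} [Field K] (q : K) (n m : ℤ) : K :=
  if 0 ≤ m ∧ m ≤ n then qShifted q q n / (qShifted q q m * qShifted q q (n - m)) else 0

/-- The summand in the definition of the A₂ supernomial. -/
def supernomialTerm {K : Type*} [Field K] (q : K) (L₁ L₂ l₁ l₂ m : ℤ) : K :=
  qBin q (l₁ - l₂ + 2 * m) m * qBin q L₁ (l₁ - L₂ + m) * qBin q L₂ (l₂ - m)

/-- Only finitely many integers `m` contribute to the A₂ supernomial. -/
theorem supernomialTerm_support {K : Type*} [Field K] (q : K) (L₁ L₂ l₁ l₂ : ℤ) :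
    (Function.support (supernomialTerm q L₁ L₂ l₁ l₂)) ⊆ Set.Icc 0 l₂ := by
  intro m hm
  by_contra h
  apply hm
  rw [Set.mem_Icc, not_and_or] at h
  rcases h with h | h
  · simp [supernomialTerm, qBin, h]
  · have h' : ¬ (0 ≤ l₂ - m) := by omega
    simp only [supernomialTerm, qBin, h', false_and, if_false, mul_zero]

/-- The (completely antisymmetric) A₂ supernomial `[L₁, L₂; l 0, l 1, l 2]`:
`∑_m [l₁ - l₂ + 2 m; m] [L₁; l₁ - L₂ + m] [L₂; l₂ - m]`, the sum being over all integers `m`,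
if `l₁ + l₂ + l₃ = L₁ + 2 L₂`, and zero otherwise. -/
noncomputable def supernomial {K : Type*} [Field K] (q : K) (L₁ L₂ : ℤ) (l : Fin 3 → ℤ) : K :=
  if l 0 + l 1 + l 2 = L₁ + 2 * L₂ then ∑ᶠ m : ℤ, supernomialTerm q L₁ L₂ (l 0) (l 1) m else 0

/-- The triples of integers `(k₁, k₂, k₃)` with `k₁ + k₂ + k₃ = 0`. -/
abbrev ZeroSumTriple : Type := {k : Fin 3 → ℤ // k 0 + k 1 + k 2 = 0}

/-- `∑_s (3 k_s - 2 σ_s) k_s`, where the permutation `σ` of `{0, 1, 2}` stands for the permutation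
`s ↦ σ_s` of `{1, 2, 3}` obtained by adding `1` to indices and values. -/
def doubleExponent (k : Fin 3 → ℤ) (σ : Equiv.Perm (Fin 3)) : ℤ :=
  ∑ s : Fin 3, (3 * k s - 2 * (((σ s).val : ℤ) + 1)) * k s

/-- On zero-sum triples, half of `doubleExponent` is an integer. -/
theorem two_dvd_doubleExponent (k : ZeroSumTriple) (σ : Equiv.Perm (Fin 3)) :
    2 ∣ doubleExponent k.1 σ := by
  obtain ⟨k, hk⟩ := k
  have h2 : k 2 = -k 0 - k 1 := by omega
  simp only [doubleExponent, Fin.sum_univ_three, h2]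
  exact ⟨3 * k 0 ^ 2 + 3 * k 0 * k 1 + 3 * k 1 ^ 2 - (((σ 0).val : ℤ) + 1) * k 0
    - (((σ 1).val : ℤ) + 1) * k 1 + (((σ 2).val : ℤ) + 1) * (k 0 + k 1), by ring⟩

/-- The term of the left-hand side of the supernomial identity that belongs to `k` and `σ`:
the lower entries of the supernomial are `L₂ - 3 k_s + σ_s - s` for `s = 1, 2, 3`, with `ℓ` added
to the first one. The division by `2` in the exponent is exact. -/
noncomputable def superTerm {K : Type*} [Field K] (q : K) (L₁ L₂ ℓ : ℤ)
    (k : ZeroSumTriple) (σ : Equiv.Perm (Fin 3)) : K :=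
  ((Equiv.Perm.sign σ : ℤ) : K) * q ^ (doubleExponent k.1 σ / 2) *
    supernomial q (2 * L₁ - L₂ + ℓ) (2 * L₂ - L₁)
      ![L₂ - 3 * k.1 0 + (((σ 0).val : ℤ) + 1) - 1 + ℓ,
        L₂ - 3 * k.1 1 + (((σ 1).val : ℤ) + 1) - 2,
        L₂ - 3 * k.1 2 + (((σ 2).val : ℤ) + 1) - 3]

/-- The right-hand side of the supernomial identity. -/
def superRHS {K : Type*} [Field K] (q : K) (L₁ L₂ ℓ : ℤ) : K :=
  q ^ (L₁ ^ 2 - L₁ * L₂ + L₂ ^ 2 + ℓ * L₁) * qShifted q q ℓ /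
    (qShifted (q ^ (-ℓ)) q (-L₁) * qShifted q q (-L₂))

/-! Put `w_s = 3 k_s - σ_s`, so that `w₁ + w₂ + w₃ = -6`. The pairs `(k, σ)` correspond to the
points `(w₁, w₂)` for which `w₁, w₂, w₃` are distinct modulo 3, and `ε(σ)` becomes the mod 3
character `charThree` of `w₂ - w₃`. It vanishes at all other points, so the double sum is a sum over
the whole lattice (`weightIndex_injective`, `mem_range_weightIndex`).

The A₂ supernomial is unchanged when its first and third lower entries are exchanged
(`splitSum_swap`). After this exchange `ℓ` no longer occurs in the two explicit lower entries, and
the summand is a product of three `q`-binomials whose lower entries `i`, `j`, `r` are independent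
summation indices, the third having upper entry `n = i + (2 L₂ - L₁) - j`. For fixed `i, j` the sum
over `r` is a level one A₁ sum, which collapses to a single signed power of `q`
(`finsum_charThree_qBin`). Its exponent separates into a part in `i` and a part in `j`, so two
applications of the `q`-binomial theorem (`finsum_qBin`) give a product of two shifted factorials,
which `superRHS_eq` identifies with the right-hand side. -/

/-! ### Gaussian polynomials and the `q`-binomial theorem. -/

section QBinomial

variable {K : Type*} [Field K] {q : K}

theorem one_sub_zpow_ne_zero (hq : ∀ n : ℕ, 0 < n → q ^ n ≠ 1) {n : ℤ} (hn : n ≠ 0) :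
    1 - q ^ n ≠ 0 := by
  have key : q ^ n.natAbs ≠ 1 := hq _ (by omega)
  intro h
  have h' : q ^ n = 1 := (sub_eq_zero.1 h).symm
  apply key
  rcases Int.natAbs_eq n with h2 | h2
  · rw [h2] at h'
    exact_mod_cast h'
  · rw [h2, zpow_neg, inv_eq_one] at h'
    exact_mod_cast h'

theorem qShifted_natCast (a q : K) (n : ℕ) :
    qShifted a q n = ∏ k ∈ Finset.range n, (1 - a * q ^ k) := by
  simp [qShifted]

theorem qShifted_neg_natCast (a q : K) (n : ℕ) :
    qShifted a q (-n) = (∏ k ∈ Finset.Icc 1 n, (1 - a * q ^ (-(k : ℤ))))⁻¹ := by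
  rcases n with _ | n
  · simp [qShifted]
  · rw [qShifted, if_neg (by push_cast; omega)]
    simp

theorem qShifted_self_of_pos {n : ℤ} (hn : 0 < n) :
    qShifted q q n = qShifted q q (n - 1) * (1 - q ^ n) := by
  obtain ⟨m, rfl⟩ : ∃ m : ℕ, n = m + 1 := ⟨(n - 1).toNat, by omega⟩
  rw [add_sub_cancel_right, qShifted_natCast]
  have : ((m : ℤ) + 1) = ((m + 1 : ℕ) : ℤ) := by push_cast; ring
  rw [this, qShifted_natCast, Finset.prod_range_succ, zpow_natCast, pow_succ']

theorem qShifted_self_ne_zero (hq : ∀ n : ℕ, 0 < n → q ^ n ≠ 1) {n : ℤ}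
    (hn : 0 ≤ n) : qShifted q q n ≠ 0 := by
  lift n to ℕ using hn
  rw [qShifted_natCast, Finset.prod_ne_zero_iff]
  intro k _ h
  apply hq (k + 1) (by omega)
  rw [pow_succ']
  exact (sub_eq_zero.1 h).symm

theorem qShifted_zero (a q : K) : qShifted a q 0 = 1 := by
  simp [qShifted]

theorem qBin_of_neg (q : K) {n m : ℤ} (h : m < 0) : qBin q n m = 0 :=
  if_neg (by omega)

theorem qBin_of_lt (q : K) {n m : ℤ} (h : n < m) : qBin q n m = 0 :=
  if_neg (by omega)

theorem qBin_of_le {n m : ℤ} (h0 : 0 ≤ m) (h : m ≤ n) :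
    qBin q n m = qShifted q q n / (qShifted q q m * qShifted q q (n - m)) :=
  if_pos ⟨h0, h⟩

theorem qBin_ne_zero {n m : ℤ} (h : qBin q n m ≠ 0) : 0 ≤ m ∧ m ≤ n := by
  by_contra h'
  exact h (if_neg h')

theorem qBin_symm (q : K) (n m : ℤ) : qBin q n m = qBin q n (n - m) := by
  by_cases h : 0 ≤ m ∧ m ≤ n
  · rw [qBin_of_le h.1 h.2, qBin_of_le (by omega) (by omega), mul_comm, sub_sub_cancel]
  · rw [qBin, qBin, if_neg h, if_neg (by omega)]

theorem qBin_absorb (hq : ∀ n : ℕ, 0 < n → q ^ n ≠ 1) (n m : ℤ) :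
    (1 - q ^ m) * qBin q n m = (1 - q ^ n) * qBin q (n - 1) (m - 1) := by
  by_cases h : 0 < m ∧ m ≤ n
  · rw [qBin_of_le h.1.le h.2, qBin_of_le (by omega) (by omega),
      qShifted_self_of_pos (n := n) (by omega), qShifted_self_of_pos h.1,
      show n - 1 - (m - 1) = n - m by ring]
    have h1 := one_sub_zpow_ne_zero hq (n := m) (by omega)
    have h2 := qShifted_self_ne_zero hq (n := n - m) (by omega)
    have h3 := qShifted_self_ne_zero hq (n := m - 1) (by omega)
    field_simp
  · by_cases hm : 0 < m
    · rw [qBin_of_lt q (by omega : n < m), qBin_of_lt q (by omega : n - 1 < m - 1)]; simp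
    · rw [qBin_of_neg q (by omega : m - 1 < 0)]
      rcases (show m < 0 ∨ m = 0 by omega) with h | rfl
      · rw [qBin_of_neg q h]; simp
      · simp

theorem qBin_absorb' (hq : ∀ n : ℕ, 0 < n → q ^ n ≠ 1) (n m : ℤ) :
    (1 - q ^ (n - m)) * qBin q n m = (1 - q ^ n) * qBin q (n - 1) m := by
  rw [qBin_symm, qBin_absorb hq, qBin_symm q (n - 1) m]
  congr 2; ring

theorem qBin_pred_right (hq : ∀ n : ℕ, 0 < n → q ^ n ≠ 1) {n : ℤ} (hn : 0 ≤ n) (m : ℤ) :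
    (1 - q ^ (n + 1 - m)) * qBin q n (m - 1) = (1 - q ^ m) * qBin q n m := by
  have h1 := qBin_absorb hq (n + 1) m
  have h2 := qBin_absorb' hq (n + 1) m
  rw [add_sub_cancel_right] at h1 h2
  refine mul_left_cancel₀ (one_sub_zpow_ne_zero hq (n := n + 1) (by omega)) ?_
  linear_combination (1 - q ^ m) * h2 - (1 - q ^ (n + 1 - m)) * h1

/-- The bound on `n` cannot be dropped: at `n = -1`, `m = 0` the left side is 1 and the right side
0. -/
theorem qBin_pascal (hq0 : q ≠ 0) (hq : ∀ n : ℕ, 0 < n → q ^ n ≠ 1) {n : ℤ} (hn : 0 ≤ n) (m : ℤ) :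
    qBin q (n + 1) m = qBin q n (m - 1) + q ^ m * qBin q n m := by
  have h1 := qBin_absorb hq (n + 1) m
  have h2 := qBin_absorb' hq (n + 1) m
  rw [add_sub_cancel_right] at h1 h2
  have h3 : q ^ m * q ^ (n + 1 - m) = q ^ (n + 1) := by
    rw [← zpow_add₀ hq0]; congr 1; ring
  refine mul_left_cancel₀ (one_sub_zpow_ne_zero hq (n := n + 1) (by omega)) ?_
  linear_combination h1 + q ^ m * h2 + qBin q (n + 1) m * h3

theorem qBin_pascal' (hq0 : q ≠ 0) (hq : ∀ n : ℕ, 0 < n → q ^ n ≠ 1) {n : ℤ} (hn : 0 ≤ n) (m : ℤ) :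
    qBin q (n + 1) m = qBin q n m + q ^ (n + 1 - m) * qBin q n (m - 1) := by
  rw [qBin_symm, qBin_pascal hq0 hq hn, qBin_symm q n m, qBin_symm q n (m - 1),
    show n + 1 - m - 1 = n - m by ring, show n - (m - 1) = n + 1 - m by ring]

theorem qBin_zero_left (q : K) (m : ℤ) : qBin q 0 m = if m = 0 then 1 else 0 := by
  split_ifs with h
  · subst h; simp [qBin, qShifted_zero]
  · exact if_neg (by omega)

theorem qBin_mul_qBin (hq : ∀ n : ℕ, 0 < n → q ^ n ≠ 1) {x y n : ℤ} :
    qBin q n (x + y) * qBin q (x + y) y = if 0 ≤ x ∧ 0 ≤ y ∧ x + y ≤ n then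
      qShifted q q n / (qShifted q q x * qShifted q q y * qShifted q q (n - x - y)) else 0 := by
  split_ifs with h
  · rw [qBin_of_le (by omega) (by omega), qBin_of_le (by omega) (by omega),
      add_sub_cancel_right, ← sub_sub]
    have h1 := qShifted_self_ne_zero hq (n := x + y) (by omega)
    have h2 := qShifted_self_ne_zero hq (n := x) (by omega)
    have h3 := qShifted_self_ne_zero hq (n := y) (by omega)
    have h4 := qShifted_self_ne_zero hq (n := n - x - y) (by omega)
    field_simp
  · by_contra h'
    have h1 := qBin_ne_zero (left_ne_zero_of_mul h')
    have h2 := qBin_ne_zero (right_ne_zero_of_mul h')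
    omega

theorem finite_support_of_subset_Icc {f : ℤ → K} {a b : ℤ} (h : ∀ i, f i ≠ 0 → a ≤ i ∧ i ≤ b) :
    f.support.Finite :=
  (Set.finite_Icc a b).subset h

theorem finsum_shift (f : ℤ → K) (c : ℤ) : ∑ᶠ i, f (i - c) = ∑ᶠ i, f i :=
  finsum_comp_equiv (Equiv.subRight c)

theorem finsum_reflect (f : ℤ → K) (c : ℤ) : ∑ᶠ i, f (c - i) = ∑ᶠ i, f i :=
  finsum_comp_equiv (Equiv.subLeft c)

/-- The `q`-binomial theorem. -/
theorem finsum_qBin (hq0 : q ≠ 0) (hq : ∀ n : ℕ, 0 < n → q ^ n ≠ 1) {z : K} (hz : z ≠ 0) (n : ℕ) :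
    ∑ᶠ i : ℤ, (-1) ^ i * q ^ (i * (i - 1) / 2) * z ^ i * qBin q n i = qShifted z q n := by
  rw [qShifted_natCast]
  induction n with
  | zero =>
    rw [finsum_eq_single _ 0]
    · simp [qBin_zero_left]
    · intro i hi; simp [qBin_zero_left, hi]
  | succ n ih =>
    rw [Finset.prod_range_succ, ← ih]
    set f : ℤ → K := fun i => (-1) ^ i * q ^ (i * (i - 1) / 2) * z ^ i * qBin q n i with hf
    have hfs : f.support.Finite :=
      finite_support_of_subset_Icc fun i hi => qBin_ne_zero (right_ne_zero_of_mul hi)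
    have hstep : ∀ i : ℤ, (-1) ^ i * q ^ (i * (i - 1) / 2) * z ^ i * qBin q (n + 1 : ℕ) i
        = f i + -(z * q ^ n) * f (i - 1) := by
      intro i
      have e1 : i * (i - 1) / 2 = (i - 1) * (i - 1 - 1) / 2 + (i - 1) := by
        rw [show i * (i - 1) = (i - 1) * (i - 1 - 1) + (i - 1) * 2 by ring,
          Int.add_mul_ediv_right _ _ two_ne_zero]
      have e2 : (-1 : K) ^ i = (-1) ^ (i - 1) * (-1) := by
        rw [← zpow_add_one₀ (by simp), sub_add_cancel]
      have e3 : z ^ i = z ^ (i - 1) * z := by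
        rw [← zpow_add_one₀ hz, sub_add_cancel]
      have e4 : q ^ (i * (i - 1) / 2) * q ^ ((n : ℤ) + 1 - i)
          = q ^ ((i - 1) * (i - 1 - 1) / 2) * q ^ n := by
        rw [← zpow_add₀ hq0, e1, ← zpow_natCast, ← zpow_add₀ hq0]; congr 1; ring
      push_cast
      rw [qBin_pascal' hq0 hq (by positivity), mul_add]
      simp only [hf]
      congr 1
      rw [e2, e3]
      linear_combination -(-1) ^ (i - 1) * z ^ (i - 1) * z * qBin q n (i - 1) * e4
    rw [finsum_congr hstep, finsum_add_distrib hfs, ← mul_finsum, finsum_shift f 1]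
    · ring
    · refine (hfs.image (· + 1)).subset fun i hi => ⟨i - 1, right_ne_zero_of_mul hi, by simp⟩

end QBinomial

/-! ### Symmetry of the supernomial in its first and third lower entries. -/

section Symmetry

variable {K : Type*} [Field K] {q : K}

/-- The summand of the A₂ supernomial `[a, b; x, y, a + 2 b - x - y]`, indexed by the lower entry of
the middle factor. -/
def splitTerm (q : K) (a b x y j : ℤ) : K :=
  qBin q a (x + y - b - j) * qBin q b j * qBin q (x + y - 2 * j) (y - j)

/-- The A₂ supernomial `[a, b; x, y, a + 2 b - x - y]` with its last lower entry suppressed. -/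
noncomputable def splitSum (q : K) (a b x y : ℤ) : K :=
  ∑ᶠ j : ℤ, splitTerm q a b x y j

theorem supernomialTerm_eq_splitTerm (q : K) (a b x y m : ℤ) :
    supernomialTerm q a b x y m = splitTerm q a b x y (y - m) := by
  rw [supernomialTerm, splitTerm, show x + y - b - (y - m) = x - b + m by ring,
    show x + y - 2 * (y - m) = x - y + 2 * m by ring, sub_sub_cancel]
  ring

theorem supernomial_eq_splitSum (q : K) {a b : ℤ} {l : Fin 3 → ℤ}
    (h : l 0 + l 1 + l 2 = a + 2 * b) : supernomial q a b l = splitSum q a b (l 0) (l 1) := by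
  rw [supernomial, if_pos h, splitSum, ← finsum_reflect (splitTerm q a b (l 0) (l 1)) (l 1)]
  exact finsum_congr fun m => supernomialTerm_eq_splitTerm ..

theorem splitTerm_ne_zero {a b x y j : ℤ} (h : splitTerm q a b x y j ≠ 0) :
    0 ≤ j ∧ j ≤ b ∧ b + j ≤ x + y ∧ x + y ≤ a + b + j ∧ j ≤ x ∧ j ≤ y := by
  have h1 := qBin_ne_zero (left_ne_zero_of_mul (left_ne_zero_of_mul h))
  have h2 := qBin_ne_zero (right_ne_zero_of_mul (left_ne_zero_of_mul h))
  have h3 := qBin_ne_zero (right_ne_zero_of_mul h)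
  omega

theorem finite_support_splitTerm (q : K) (a b x y : ℤ) : (splitTerm q a b x y).support.Finite :=
  finite_support_of_subset_Icc (a := 0) (b := b) fun _ hi =>
    ⟨(splitTerm_ne_zero hi).1, (splitTerm_ne_zero hi).2.1⟩

theorem finite_support_shift {f : ℤ → K} (hf : f.support.Finite) (c : ℤ) :
    (fun j => f (j - c)).support.Finite :=
  (hf.image (· + c)).subset fun i hi => ⟨i - c, hi, by simp⟩

theorem splitSum_of_neg_left (q : K) {a : ℤ} (ha : a < 0) (b x y : ℤ) : splitSum q a b x y = 0 :=
  finsum_eq_zero_of_forall_eq_zero fun j => by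
    by_contra h
    have := splitTerm_ne_zero h
    omega

/-- With `z = a + 2 b + 1 - x - y`, the left side is the sum over the three ways of lowering one of
`x, y, z` by 1, and the supernomials on the right have lower entries `(x, y, z)`, `(x, y, z)` and
`(x - 1, y - 1, z - 1)`. The shape is therefore symmetric in `x, y, z`, which lets symmetry
propagate from smaller `b` to `b + 1`. -/
theorem splitSum_recurrence (hq0 : q ≠ 0) (hq : ∀ n : ℕ, 0 < n → q ^ n ≠ 1) {a b : ℤ} (ha : 0 ≤ a)
    (hb : 0 ≤ b) (x y : ℤ) :
    splitSum q a b (x - 1) y + splitSum q a b x (y - 1) + splitSum q a b x y =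
      splitSum q (a + 1) b x y + (1 - q ^ a) * splitSum q (a - 1) (b + 1) x y
        + (1 - q ^ b) * splitSum q a (b - 1) (x - 1) (y - 1) := by
  set u : ℤ → K := fun j => qBin q a (x + y - b - j - 1) * qBin q b j *
    ((1 - q ^ (x + y - 2 * j - 1)) * qBin q (x + y - 2 * j - 2) (y - j - 1)) with hu
  set v : ℤ → K := fun j => qBin q a (x + y - b - j - 1) * qBin q b j *
    qBin q (x + y - 2 * j) (y - j) with hv
  have hus : u.support.Finite := finite_support_of_subset_Icc (a := 0) (b := b) fun i hi =>
    qBin_ne_zero (right_ne_zero_of_mul (left_ne_zero_of_mul hi))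
  have hvs : v.support.Finite := finite_support_of_subset_Icc (a := 0) (b := b) fun i hi =>
    qBin_ne_zero (right_ne_zero_of_mul (left_ne_zero_of_mul hi))
  have hws := finite_support_splitTerm q a (b - 1) (x - 1) (y - 1)
  have hts := finite_support_splitTerm q a b x y
  have hL : splitSum q a b (x - 1) y + splitSum q a b x (y - 1) = ∑ᶠ j, (v j + u j) := by
    rw [splitSum, splitSum, ← finsum_add_distrib (finite_support_splitTerm ..)
      (finite_support_splitTerm ..)]
    refine finsum_congr fun j => ?_
    simp only [hu, hv, splitTerm]
    rw [show x - 1 + y - b - j = x + y - b - j - 1 by ring,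
      show x + (y - 1) - b - j = x + y - b - j - 1 by ring,
      show x - 1 + y - 2 * j = x + y - 2 * j - 1 by ring,
      show x + (y - 1) - 2 * j = x + y - 2 * j - 1 by ring,
      show y - 1 - j = y - j - 1 by ring, ← mul_add, ← mul_add]
    by_cases hz : qBin q a (x + y - b - j - 1) * qBin q b j = 0
    · rw [hz, zero_mul, zero_mul]
    have h1 := qBin_ne_zero (left_ne_zero_of_mul hz)
    have h2 := qBin_ne_zero (right_ne_zero_of_mul hz)
    have h3 := qBin_pascal hq0 hq (n := x + y - 2 * j - 1) (by omega) (y - j)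
    have h4 := qBin_absorb hq (x + y - 2 * j - 1) (y - j)
    rw [sub_add_cancel] at h3
    rw [sub_sub _ (1 : ℤ) 1, one_add_one_eq_two] at h4
    congr 1
    linear_combination h4 - h3
  -- Shifting `j` in `u` and in the last sum gives all terms the common factor `qBin q (x + y - 2 *
  -- j) (y - j)`; what remains involves only the first two factors.
  rw [hL, finsum_add_distrib hvs hus, ← finsum_shift u 1, splitSum, splitSum, splitSum, splitSum,
    ← finsum_shift (splitTerm q a (b - 1) (x - 1) (y - 1)) 1, mul_finsum, mul_finsum,
    ← finsum_add_distrib hvs (finite_support_shift hus 1), ← finsum_add_distrib _ hts,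
    ← finsum_add_distrib (finite_support_splitTerm ..), ← finsum_add_distrib]
  · refine finsum_congr fun j => ?_
    simp only [hu, hv, splitTerm]
    rw [show x + y - b - (j - 1) - 1 = x + y - b - j by ring,
      show x + y - 2 * (j - 1) - 1 = x + y - 2 * j + 1 by ring,
      show x + y - 2 * (j - 1) - 2 = x + y - 2 * j by ring,
      show y - (j - 1) - 1 = y - j by ring,
      show x + y - (b + 1) - j = x + y - b - j - 1 by ring,
      show x - 1 + (y - 1) - (b - 1) - (j - 1) = x + y - b - j by ring,
      show x - 1 + (y - 1) - 2 * (j - 1) = x + y - 2 * j by ring,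
      show y - 1 - (j - 1) = y - j by ring]
    have h1 := qBin_pascal hq0 hq ha (x + y - b - j)
    have h2 := qBin_pascal' hq0 hq hb j
    have h3 := qBin_absorb hq a (x + y - b - j)
    have h4 := qBin_absorb hq b j
    have h5 := qBin_pred_right hq hb j
    have h6 : q ^ (x + y - 2 * j + 1) = q ^ (x + y - b - j) * q ^ (b + 1 - j) := by
      rw [← zpow_add₀ hq0]; congr 1; ring
    rw [h1, h2, h6]
    linear_combination qBin q (x + y - 2 * j) (y - j) *
      ((qBin q b j + q ^ (b + 1 - j) * qBin q b (j - 1)) * h3 + qBin q a (x + y - b - j) * (h4 + h5))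
  · exact ((finite_support_splitTerm q (a + 1) b x y).union
      ((finite_support_splitTerm q (a - 1) (b + 1) x y).subset
        fun i hi => right_ne_zero_of_mul hi)).subset (Function.support_add ..)
  · exact (finite_support_shift hws 1).subset fun i hi => right_ne_zero_of_mul hi
  · exact (finite_support_splitTerm q (a - 1) (b + 1) x y).subset fun i hi => right_ne_zero_of_mul hi
  · exact (hvs.union (finite_support_shift hus 1)).subset (Function.support_add ..)

/-- For `b = 0` only `j = 0` survives, leaving a `q`-trinomial coefficient, symmetric by
`qBin_mul_qBin`. -/
theorem splitSum_zero_swap (hq : ∀ n : ℕ, 0 < n → q ^ n ≠ 1) (a x y : ℤ) :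
    splitSum q a 0 x y = splitSum q a 0 (a - x - y) y := by
  have key : ∀ x, splitSum q a 0 x y = qBin q a (x + y) * qBin q (x + y) y := by
    intro x
    rw [splitSum, finsum_eq_single _ 0]
    · simp [splitTerm, qBin_zero_left]
    · intro j hj
      simp [splitTerm, qBin_zero_left, hj]
  rw [key, key, qBin_mul_qBin hq, qBin_mul_qBin hq]
  refine if_congr (by omega) ?_ rfl
  rw [show a - (a - x - y) - y = x by ring]
  congr 1
  ring

theorem splitSum_swap (hq0 : q ≠ 0) (hq : ∀ n : ℕ, 0 < n → q ^ n ≠ 1) (b : ℕ) :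
    ∀ a x y : ℤ, splitSum q a b x y = splitSum q a b (a + 2 * b - x - y) y := by
  induction b using Nat.strong_induction_on with
  | _ b ih =>
    rcases b with _ | b
    · intro a x y
      simpa using splitSum_zero_swap hq a x y
    intro a x y
    rcases lt_or_ge a 0 with ha | ha
    · rw [splitSum_of_neg_left q ha, splitSum_of_neg_left q ha]
    -- For `b = 0` the prefactor vanishes, so no symmetry is needed at upper entry `-1`.
    have hlow : (1 - q ^ (b : ℤ)) * splitSum q (a + 1) (b - 1) (x - 1) (y - 1) =
        (1 - q ^ (b : ℤ)) * splitSum q (a + 1) (b - 1) (a + 2 * (b + 1) - x - y - 1) (y - 1) := by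
      rcases b with _ | b
      · simp
      · have := ih b (by omega) (a + 1) (x - 1) (y - 1)
        push_cast
        rw [add_sub_cancel_right, this]
        congr 2
        ring
    have r1 := splitSum_recurrence hq0 hq (a := a + 1) (by omega) (Int.natCast_nonneg b) x y
    have r2 := splitSum_recurrence hq0 hq (a := a + 1) (by omega) (Int.natCast_nonneg b)
      (a + 2 * (b + 1) - x - y) y
    have i1 := ih b (by omega) (a + 1) (x - 1) y
    have i2 := ih b (by omega) (a + 1) x (y - 1)
    have i3 := ih b (by omega) (a + 1) x y
    have i4 := ih b (by omega) (a + 1 + 1) x y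
    rw [show a + 1 + 2 * (b : ℤ) - (x - 1) - y = a + 2 * (b + 1) - x - y by ring] at i1
    rw [show a + 1 + 2 * (b : ℤ) - x - (y - 1) = a + 2 * (b + 1) - x - y by ring] at i2
    rw [show a + 1 + 2 * (b : ℤ) - x - y = a + 2 * (b + 1) - x - y - 1 by ring] at i3
    rw [show a + 1 + 1 + 2 * (b : ℤ) - x - y = a + 2 * (b + 1) - x - y by ring] at i4
    rw [add_sub_cancel_right] at r1 r2
    push_cast
    -- The recurrence is solved for its term with upper entries `a, b + 1`.
    refine mul_left_cancel₀ (one_sub_zpow_ne_zero hq (n := a + 1) (by omega)) ?_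
    linear_combination r2 - r1 + i1 + i2 + i3 - i4 - hlow

end Symmetry

/-! ### Collapse of level one A₁ sums. -/

section CharacterSum

/-- The nonprincipal Dirichlet character modulo `3`. -/
def charThree (d : ℤ) : ℤ :=
  if d % 3 = 1 then 1 else if d % 3 = 2 then -1 else 0

theorem charThree_neg (d : ℤ) : charThree (-d) = -charThree d := by
  unfold charThree
  split_ifs <;> omega

theorem charThree_add_three (d : ℤ) : charThree (d + 3) = charThree d := by
  simp [charThree]

theorem charThree_ne_zero {d : ℤ} : charThree d ≠ 0 ↔ d % 3 ≠ 0 := by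
  unfold charThree
  split_ifs <;> omega

variable {K : Type*} [Field K]

theorem sum_Icc_eq_finsum_qBin (q : K) (f : ℤ → K) (n : ℤ) :
    ∑ᶠ r, f r * qBin q n r = ∑ r ∈ Finset.Icc 0 n, f r * qBin q n r :=
  finsum_eq_sum_of_support_subset _ fun r hr => by
    simpa using qBin_ne_zero (right_ne_zero_of_mul hr)

theorem finsum_charThree_antisymm (t q : K) (n : ℤ) :
    ∑ᶠ r : ℤ, (charThree (n - 2 * r) : K) * t ^ (2 * r * (r - n)) * qBin q n r = 0 := by
  rw [sum_Icc_eq_finsum_qBin]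
  -- Terms cancel in pairs under `r ↦ n - r`, and a fixed point has character value 0. Deducing `S =
  -- 0` from `S = -S` would fail in characteristic 2.
  refine Finset.sum_involution (fun r _ => n - r) ?_ ?_ ?_ ?_
  · intro r _
    rw [← qBin_symm, show n - 2 * (n - r) = -(n - 2 * r) by ring, charThree_neg,
      show 2 * (n - r) * (n - r - n) = 2 * r * (r - n) by ring]
    push_cast
    ring
  · intro r _ hr h
    apply hr
    rw [show n - 2 * r = 0 by omega]
    simp [charThree]
  · intro r hr
    rw [Finset.mem_Icc] at hr ⊢
    omega
  · intro r _
    ring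

/-- A sign-alternating A₁ sum at level one collapses to a power; here `q = t ^ 6`. -/
theorem finsum_charThree_qBin {t : K} (ht : t ≠ 0) (hq : ∀ n : ℕ, 0 < n → (t ^ 6) ^ n ≠ 1)
    (n : ℕ) :
    ∑ᶠ r : ℤ, (charThree (n + 1 - 2 * r) : K) * t ^ (2 * r * (r - n - 1)) * qBin (t ^ 6) n r
      = (-1) ^ n * t ^ ((n : ℤ) * (n - 1)) := by
  induction n with
  | zero =>
    rw [finsum_eq_single _ 0]
    · simp [charThree, qBin_zero_left]
    · intro r hr
      simp [qBin_zero_left, hr]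
  | succ n ih =>
    have ht6 : t ^ 6 ≠ 0 := pow_ne_zero 6 ht
    set g : ℤ → K := fun r =>
      (charThree (n + 1 - 2 * r) : K) * t ^ (2 * r * (r - n - 1)) * qBin (t ^ 6) n r with hg
    set u : ℤ → K := fun r =>
      (charThree (n - 2 * r) : K) * t ^ (2 * r * (r - n)) * qBin (t ^ 6) n r with hu
    have hgs : g.support.Finite := finite_support_of_subset_Icc fun r hr =>
      qBin_ne_zero (right_ne_zero_of_mul hr)
    have hus : u.support.Finite := finite_support_of_subset_Icc fun r hr =>
      qBin_ne_zero (right_ne_zero_of_mul hr)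
    have hu0 : ∑ᶠ r, u r = 0 := finsum_charThree_antisymm t (t ^ 6) n
    -- Pascal's rule splits the sum into a shift of the antisymmetric sum, which is zero, and a
    -- reflection of the sum for `n`; the sign comes from `charThree` being odd of period 3.
    have hstep : ∀ r : ℤ, (charThree ((n + 1 : ℕ) + 1 - 2 * r) : K) *
        t ^ (2 * r * (r - (n + 1 : ℕ) - 1)) * qBin (t ^ 6) (n + 1 : ℕ) r
        = t ^ (-2 * (n + 1) : ℤ) * u (r - 1) + -t ^ (2 * n : ℤ) * g (n - r) := by
      intro r
      simp only [hu, hg]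
      push_cast
      rw [qBin_pascal ht6 hq (Int.natCast_nonneg n), ← qBin_symm,
        show (n : ℤ) + 1 + 1 - 2 * r = n - 2 * (r - 1) by ring]
      have e1 : t ^ (2 * r * (r - (n + 1) - 1)) =
          t ^ (-2 * (n + 1) : ℤ) * t ^ (2 * (r - 1) * (r - 1 - n)) := by
        rw [← zpow_add₀ ht]; congr 1; ring
      have e2 : t ^ (2 * r * (r - (n + 1) - 1)) * (t ^ 6) ^ r =
          t ^ (2 * n : ℤ) * t ^ (2 * (n - r) * (n - r - n - 1)) := by
        rw [← zpow_natCast t 6, ← zpow_mul, ← zpow_add₀ ht, ← zpow_add₀ ht]; congr 1; push_cast; ring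
      have e3 : (charThree (n - 2 * (r - 1)) : K) = -charThree (n + 1 - 2 * (n - r)) := by
        rw [← Int.cast_neg, ← charThree_neg, ← charThree_add_three (-_)]
        congr 2; ring
      rw [mul_add]
      congr 1
      · rw [e1]; ring
      · rw [e3]
        linear_combination -(charThree (n + 1 - 2 * (n - r)) : K) * qBin (t ^ 6) n r * e2
    rw [finsum_congr hstep, finsum_add_distrib, ← mul_finsum, ← mul_finsum, finsum_shift, hu0,
      finsum_reflect, ih]
    · rw [mul_zero, zero_add, pow_succ, mul_left_comm, neg_mul, ← zpow_add₀ ht]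
      push_cast
      rw [show (2 : ℤ) * n + n * (n - 1) = (n + 1) * (n + 1 - 1) by ring]
      ring
    · exact (finite_support_shift hus 1).subset fun i hi => right_ne_zero_of_mul hi
    · refine (hgs.image ((n : ℤ) - ·)).subset fun i hi =>
        ⟨n - i, right_ne_zero_of_mul hi, sub_sub_cancel ..⟩

theorem qBin_map {F : Type*} [Field F] (φ : K →+* F) (q : K) (n m : ℤ) :
    φ (qBin q n m) = qBin (φ q) n m := by
  have h : ∀ n, φ (qShifted q q n) = qShifted (φ q) (φ q) n := by
    intro n
    unfold qShifted
    split_ifs <;> simp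
  unfold qBin
  split_ifs <;> simp [h]

/-- The collapse of a level one A₁ sum, with the exponents `e r` known up to a common shift. -/
theorem finsum_charThree_qBin_of_exponent {q : K} (hq0 : q ≠ 0)
    (hq : ∀ n : ℕ, 0 < n → q ^ n ≠ 1) (n : ℕ) (e : ℤ → ℤ) (c f : ℤ)
    (he : ∀ r, charThree (n + 1 - 2 * r) ≠ 0 → 6 * e r = 2 * r * (r - n - 1) + c)
    (hf : 6 * f = n * (n - 1) + c) :
    ∑ᶠ r : ℤ, (charThree (n + 1 - 2 * r) : K) * q ^ e r * qBin q n r = (-1) ^ n * q ^ f := by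
  -- A sixth root of `q` is adjoined because the separate parts of the exponent are integral only
  -- after multiplication by 6.
  obtain ⟨t, ht⟩ := IsAlgClosed.exists_pow_nat_eq (algebraMap K (AlgebraicClosure K) q)
    (n := 6) (by norm_num)
  set φ := algebraMap K (AlgebraicClosure K) with hφ
  have hinj : Function.Injective φ := φ.injective
  have ht0 : t ≠ 0 := by
    rintro rfl
    apply hq0
    apply hinj
    rw [← ht]
    simp
  have ht6 : ∀ n : ℕ, 0 < n → (t ^ 6) ^ n ≠ 1 := by
    intro n hn h
    apply hq n hn
    apply hinj
    rw [map_pow, ← ht, h, map_one]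
  have key := finsum_charThree_qBin ht0 ht6 n
  rw [sum_Icc_eq_finsum_qBin] at key ⊢
  apply hinj
  have hpow : ∀ k : ℤ, φ (q ^ k) = t ^ (6 * k) := by
    intro k
    rw [map_zpow₀, ← ht, zpow_mul]
    norm_cast
  rw [map_mul, hpow, hf, zpow_add₀ ht0, map_pow, map_neg, map_one, ← mul_assoc, ← key, map_sum,
    Finset.sum_mul]
  refine Finset.sum_congr rfl fun r _ => ?_
  rw [map_mul, map_mul, hpow, qBin_map, map_intCast, ← ht]
  by_cases hc : charThree (n + 1 - 2 * r) = 0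
  · simp [hc]
  · rw [he r hc, zpow_add₀ ht0]
    ring

end CharacterSum

/-! ### The right-hand side as a product of two shifted factorials. -/

section ClosedForm

variable {K : Type*} [Field K] {q : K}

theorem qShifted_zpow_neg_eq_zero (hq0 : q ≠ 0) {m n : ℤ} (hm : 0 ≤ m) (h : m < n) :
    qShifted (q ^ (-m)) q n = 0 := by
  lift m to ℕ using hm
  lift n to ℕ using by omega
  rw [qShifted_natCast]
  refine Finset.prod_eq_zero (i := m) (Finset.mem_range.2 (by omega)) ?_
  rw [zpow_neg, zpow_natCast, inv_mul_cancel₀ (pow_ne_zero _ hq0), sub_self]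

theorem qShifted_zpow_succ_mul (hq0 : q ≠ 0) {m n : ℤ} (hm : 0 ≤ m) (hn : 0 ≤ n) :
    qShifted q q m * qShifted (q ^ (m + 1)) q n = qShifted q q (m + n) := by
  lift n to ℕ using hn
  induction n with
  | zero => simp [qShifted_zero]
  | succ n ih =>
    rw [qShifted_natCast, Finset.prod_range_succ, ← qShifted_natCast, ← mul_assoc, ih,
      qShifted_self_of_pos (n := m + (n + 1 : ℕ)) (by omega)]
    push_cast
    rw [show m + (n + 1 : ℤ) - 1 = m + n by ring, ← zpow_natCast q n, ← zpow_add₀ hq0]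
    congr 3
    ring

theorem qShifted_zpow_neg_mul (hq0 : q ≠ 0) (l m : ℕ) (h : m ≤ l) :
    qShifted (q ^ (-(l : ℤ))) q m * qShifted q q (l - m) =
      (-1) ^ m * q ^ ((m : ℤ) * (m - 1) / 2 - l * m) * qShifted q q l := by
  induction m with
  | zero => simp [qShifted_zero]
  | succ m ih =>
    have ih := ih (by omega)
    rw [qShifted_self_of_pos (n := l - m) (by omega)] at ih
    rw [qShifted_natCast, Finset.prod_range_succ, ← qShifted_natCast]
    push_cast
    rw [show (l : ℤ) - (m + 1) = l - m - 1 by ring]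
    have e1 : ((m : ℤ) + 1) * (m + 1 - 1) / 2 = m * (m - 1) / 2 + m := by
      rw [show ((m : ℤ) + 1) * (m + 1 - 1) = m * (m - 1) + m * 2 by ring,
        Int.add_mul_ediv_right _ _ two_ne_zero]
    have e2 : q ^ (-(l : ℤ)) * q ^ m * q ^ ((l : ℤ) - m) = 1 := by
      rw [← zpow_natCast, ← zpow_add₀ hq0, ← zpow_add₀ hq0]
      simp
    have e3 : q ^ (((m : ℤ) + 1) * (m + 1 - 1) / 2 - l * (m + 1)) =
        q ^ ((m : ℤ) * (m - 1) / 2 - l * m) * (q ^ (-(l : ℤ)) * q ^ m) := by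
      rw [e1, ← zpow_natCast, ← zpow_add₀ hq0, ← zpow_add₀ hq0]
      congr 1
      ring
    rw [e3, pow_succ]
    linear_combination -(q ^ (-(l : ℤ)) * q ^ m) * ih
      - qShifted (q ^ (-(l : ℤ))) q m * qShifted q q (l - m - 1) * e2

theorem qShifted_zpow_neg_ne_zero (hq0 : q ≠ 0) (hq : ∀ n : ℕ, 0 < n → q ^ n ≠ 1) {l m : ℤ}
    (hl : 0 ≤ l) (h : m ≤ l) : qShifted (q ^ (-l)) q m ≠ 0 := by
  lift l to ℕ using hl
  rcases le_or_gt 0 m with hm | hm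
  · lift m to ℕ using hm
    refine left_ne_zero_of_mul (b := qShifted q q (l - m)) ?_
    rw [qShifted_zpow_neg_mul hq0 l m (by omega)]
    exact mul_ne_zero (mul_ne_zero (pow_ne_zero _ (by simp)) (zpow_ne_zero _ hq0))
      (qShifted_self_ne_zero hq (by omega))
  · obtain ⟨n, rfl⟩ : ∃ n : ℕ, m = -n := ⟨(-m).toNat, by omega⟩
    rw [qShifted_neg_natCast]
    refine inv_ne_zero (Finset.prod_ne_zero_iff.2 fun k hk => ?_)
    rw [← zpow_add₀ hq0]
    rw [Finset.mem_Icc] at hk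
    exact one_sub_zpow_ne_zero hq (by omega)

/-- The infinite symbol `(q)_{-L₂}` has the value 0 in Lean, and division by 0 gives 0, in agreement
with the convention for its reciprocal. -/
theorem superRHS_of_pos (hq0 : q ≠ 0) (L₁ ℓ : ℤ) {L₂ : ℤ} (h : 0 < L₂) :
    superRHS q L₁ L₂ ℓ = 0 := by
  rw [superRHS, inv_eq_zero.1 (qShifted_self_inv_of_neg hq0 (by omega : -L₂ < 0))]
  simp

/-- For `L₂ > 0` both sides vanish, one of the two products containing the factor `1 - q ^ 0`. For
`L₂ ≤ 0` the bounds force `L₁ ≤ 2 L₂ ≤ 0` and `-L₁ ≤ ℓ`, and the products telescope to `(q)_{ℓ + L₁}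
/ (q)_{-L₂}`. -/
theorem superRHS_eq (hq0 : q ≠ 0) (hq : ∀ n : ℕ, 0 < n → q ^ n ≠ 1) {L₁ L₂ ℓ : ℤ}
    (h₁ : 0 ≤ 2 * L₁ - L₂ + ℓ) (h₂ : 0 ≤ 2 * L₂ - L₁) (hℓ : 0 ≤ ℓ) :
    superRHS q L₁ L₂ ℓ = (-1) ^ L₁ * q ^ (L₁ * (L₁ - 1) / 2 + L₂ ^ 2 - L₁ * L₂) *
      qShifted (q ^ (L₂ - L₁ + 1)) q (2 * L₁ - L₂ + ℓ) *
      qShifted (q ^ (1 - L₂)) q (2 * L₂ - L₁) := by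
  rcases lt_or_ge 0 L₂ with h | h
  · rw [superRHS_of_pos hq0 _ _ h, eq_comm]
    rcases le_or_gt L₁ L₂ with h' | h'
    · rw [show 1 - L₂ = -(L₂ - 1) by ring, qShifted_zpow_neg_eq_zero hq0 (by omega) (by omega),
        mul_zero]
    · rw [show L₂ - L₁ + 1 = -(L₁ - L₂ - 1) by ring,
        qShifted_zpow_neg_eq_zero hq0 (by omega) (by omega), mul_zero, zero_mul]
  · have p1 := qShifted_zpow_succ_mul hq0 (m := L₂ - L₁) (n := 2 * L₁ - L₂ + ℓ) (by omega) h₁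
    have p2 := qShifted_zpow_succ_mul hq0 (m := -L₂) (n := 2 * L₂ - L₁) (by omega) h₂
    rw [show L₂ - L₁ + (2 * L₁ - L₂ + ℓ) = ℓ + L₁ by ring] at p1
    rw [show -L₂ + (2 * L₂ - L₁) = L₂ - L₁ by ring, show -L₂ + 1 = 1 - L₂ by ring] at p2
    have n1 := qShifted_self_ne_zero hq (n := L₂ - L₁) (by omega)
    have n2 := qShifted_self_ne_zero hq (n := -L₂) (by omega)
    have n3 := qShifted_zpow_neg_ne_zero hq0 hq (l := ℓ) (m := -L₁) hℓ (by omega)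
    lift ℓ to ℕ using hℓ
    obtain ⟨m, rfl⟩ : ∃ m : ℕ, L₁ = -m := ⟨(-L₁).toNat, by omega⟩
    have p3 := qShifted_zpow_neg_mul hq0 ℓ m (by omega)
    rw [neg_neg] at n3
    rw [superRHS, neg_neg, div_eq_iff (mul_ne_zero n3 n2)]
    have e1 : q ^ ((-(m : ℤ)) ^ 2 - -m * L₂ + L₂ ^ 2 + ℓ * -m) =
        q ^ (-(m : ℤ) * (-m - 1) / 2 + L₂ ^ 2 - -m * L₂) * q ^ ((m : ℤ) * (m - 1) / 2 - ℓ * m) := by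
      rw [← zpow_add₀ hq0]
      congr 1
      have a1 := Int.ediv_mul_cancel (Int.even_mul_pred_self (m : ℤ)).two_dvd
      rw [show -(m : ℤ) * (-m - 1) = m * (m - 1) + m * 2 by ring,
        Int.add_mul_ediv_right _ _ two_ne_zero]
      linear_combination -a1
    have e2 : ((-1 : K) ^ (-(m : ℤ))) * (-1) ^ m = 1 := by
      rw [zpow_neg, zpow_natCast, inv_mul_cancel₀ (pow_ne_zero _ (by simp))]
    rw [e1]
    set A := q ^ (-(m : ℤ) * (-m - 1) / 2 + L₂ ^ 2 - -m * L₂)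
    set B := q ^ ((m : ℤ) * (m - 1) / 2 - ℓ * m)
    set Y := qShifted (q ^ (1 - L₂)) q (2 * L₂ - -m)
    set X := qShifted (q ^ (L₂ - -m + 1)) q (2 * -m - L₂ + ℓ)
    set D := qShifted (q ^ (-(ℓ : ℤ))) q m
    set s := (-1 : K) ^ (-(m : ℤ))
    rw [← sub_eq_add_neg] at p1
    linear_combination (-A * B * qShifted q q ℓ) * e2 - A * s * p3 - A * s * D * p1 - A * s * D * X * p2

end ClosedForm

/-! ### The triple sum over independent indices. -/

section AffineSum

variable {K : Type*} [Field K] {q : K}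

/-- Half of `doubleExponent` in the coordinates `w₁ = 3 k₁ - σ₁` and `w₂ = 3 k₂ - σ₂`. -/
def affineExponent (w₁ w₂ : ℤ) : ℤ :=
  (w₁ ^ 2 + w₁ * w₂ + w₂ ^ 2 + 6 * w₁ + 6 * w₂ + 11) / 3

/-- The hypothesis says `w₁ ≢ w₂` modulo 3, which makes the division exact. The constant 11 is `(36
- 14) / 2`: 36 comes from `w₃ ^ 2` and 14 is `∑ σ_s ^ 2`. -/
theorem three_mul_affineExponent {w₁ w₂ : ℤ} (h : charThree (2 * w₂ + w₁ + 6) ≠ 0) :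
    3 * affineExponent w₁ w₂ = w₁ ^ 2 + w₁ * w₂ + w₂ ^ 2 + 6 * w₁ + 6 * w₂ + 11 := by
  rw [charThree_ne_zero] at h
  refine Int.mul_ediv_cancel' ?_
  obtain ⟨c, hc | hc⟩ : ∃ c, w₁ = w₂ + 3 * c + 1 ∨ w₁ = w₂ + 3 * c + 2 :=
    ⟨(w₁ - w₂) / 3, by omega⟩
  · exact ⟨w₂ ^ 2 + 3 * c * w₂ + w₂ + 3 * c ^ 2 + 2 * c + 4 * w₂ + 6 * c + 6, by rw [hc]; ring⟩
  · exact ⟨w₂ ^ 2 + 3 * c * w₂ + 2 * w₂ + 3 * c ^ 2 + 4 * c + 4 * w₂ + 6 * c + 9, by rw [hc]; ring⟩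

/-- The summand of the affine sum as a function of three independent summation indices. -/
def affineTerm (q : K) (L₁ L₂ ℓ i j r : ℤ) : K :=
  (charThree (i + (2 * L₂ - L₁) - j + 1 - 2 * r) : K) *
    q ^ affineExponent (i + j - L₁ - 1) (L₂ - 2 - j - r) *
    qBin q (i + (2 * L₂ - L₁) - j) r *
    (qBin q (2 * L₁ - L₂ + ℓ) i * qBin q (2 * L₂ - L₁) j)

theorem finsum_affineTerm_right (hq0 : q ≠ 0) (hq : ∀ n : ℕ, 0 < n → q ^ n ≠ 1) (L₁ L₂ ℓ i j : ℤ) :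
    ∑ᶠ r, affineTerm q L₁ L₂ ℓ i j r =
      (-1) ^ L₁ * q ^ (L₁ * (L₁ - 1) / 2 + L₂ ^ 2 - L₁ * L₂) *
      ((-1) ^ i * q ^ (i * (i - 1) / 2) * (q ^ (L₂ - L₁ + 1)) ^ i * qBin q (2 * L₁ - L₂ + ℓ) i) *
      ((-1) ^ j * q ^ (j * (j - 1) / 2) * (q ^ (1 - L₂)) ^ j * qBin q (2 * L₂ - L₁) j) := by
  simp only [affineTerm]
  rw [← finsum_mul]
  by_cases hz : qBin q (2 * L₁ - L₂ + ℓ) i * qBin q (2 * L₂ - L₁) j = 0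
  · rw [hz]
    linear_combination -(-1) ^ L₁ * q ^ (L₁ * (L₁ - 1) / 2 + L₂ ^ 2 - L₁ * L₂) *
      (-1) ^ i * q ^ (i * (i - 1) / 2) * (q ^ (L₂ - L₁ + 1)) ^ i *
      (-1) ^ j * q ^ (j * (j - 1) / 2) * (q ^ (1 - L₂)) ^ j * hz
  have hi := qBin_ne_zero (left_ne_zero_of_mul hz)
  have hj := qBin_ne_zero (right_ne_zero_of_mul hz)
  obtain ⟨n, hn⟩ : ∃ n : ℕ, i + (2 * L₂ - L₁) - j = n :=
    ⟨(i + (2 * L₂ - L₁) - j).toNat, by omega⟩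
  rw [hn, finsum_charThree_qBin_of_exponent hq0 hq n _
    -- The shift is six times the exponent, before rounding, at `r = 0`; the second argument is the
    -- collapsed exponent, already separated in `i` and `j`.
    (2 * ((i + j - L₁ - 1) ^ 2 + (i + j - L₁ - 1) * (L₂ - 2 - j) + (L₂ - 2 - j) ^ 2
      + 6 * (i + j - L₁ - 1) + 6 * (L₂ - 2 - j) + 11))
    (L₁ * (L₁ - 1) / 2 + L₂ ^ 2 - L₁ * L₂ + i * (i - 1) / 2 + (L₂ - L₁ + 1) * i
      + j * (j - 1) / 2 + (1 - L₂) * j)]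
  · have hs : (-1 : K) ^ n = (-1) ^ L₁ * (-1) ^ i * (-1) ^ j := by
      rw [← zpow_natCast, ← zpow_add₀ (by simp), ← zpow_add₀ (by simp), ← hn,
        show i + (2 * L₂ - L₁) - j = L₁ + i + j + 2 * (L₂ - L₁ - j) by ring,
        zpow_add₀ (by simp), zpow_mul]
      norm_num
    rw [hs, zpow_add₀ hq0, zpow_add₀ hq0, zpow_add₀ hq0, zpow_add₀ hq0, zpow_mul, zpow_mul]
    ring
  · intro r hr
    rw [← hn] at hr ⊢
    have := three_mul_affineExponent (w₁ := i + j - L₁ - 1) (w₂ := L₂ - 2 - j - r) (by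
      convert hr using 2; ring)
    linear_combination 2 * this
  · have a1 := Int.ediv_mul_cancel (Int.even_mul_pred_self i).two_dvd
    have a2 := Int.ediv_mul_cancel (Int.even_mul_pred_self j).two_dvd
    have a3 := Int.ediv_mul_cancel (Int.even_mul_pred_self L₁).two_dvd
    rw [← hn]
    linear_combination 3 * a1 + 3 * a2 + 3 * a3

theorem finite_support_affineTerm (q : K) (L₁ L₂ ℓ : ℤ) :
    (fun p : ℤ × ℤ × ℤ => affineTerm q L₁ L₂ ℓ p.2.1 p.1 p.2.2).support.Finite := by
  refine ((Set.finite_Icc 0 (2 * L₂ - L₁)).prod ((Set.finite_Icc 0 (2 * L₁ - L₂ + ℓ)).prod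
    (Set.finite_Icc 0 (L₁ + L₂ + ℓ)))).subset ?_
  rintro ⟨j, i, r⟩ h
  have h1 := qBin_ne_zero (left_ne_zero_of_mul (right_ne_zero_of_mul h))
  have h2 := qBin_ne_zero (right_ne_zero_of_mul (right_ne_zero_of_mul h))
  have h3 := qBin_ne_zero (right_ne_zero_of_mul (left_ne_zero_of_mul h))
  simp only [Set.mem_prod, Set.mem_Icc] at h1 h2 h3 ⊢
  omega

theorem finsum_affineTerm (hq0 : q ≠ 0) (hq : ∀ n : ℕ, 0 < n → q ^ n ≠ 1) {L₁ L₂ ℓ : ℤ}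
    (h₁ : 0 ≤ 2 * L₁ - L₂ + ℓ) (h₂ : 0 ≤ 2 * L₂ - L₁) (hℓ : 0 ≤ ℓ) :
    ∑ᶠ p : ℤ × ℤ × ℤ, affineTerm q L₁ L₂ ℓ p.2.1 p.1 p.2.2 = superRHS q L₁ L₂ ℓ := by
  have hfin := finite_support_affineTerm q L₁ L₂ ℓ
  rw [superRHS_eq hq0 hq h₁ h₂ hℓ, finsum_curry _ hfin]
  have hin : ∀ j, ∑ᶠ p : ℤ × ℤ, affineTerm q L₁ L₂ ℓ p.1 j p.2 =
      (-1) ^ L₁ * q ^ (L₁ * (L₁ - 1) / 2 + L₂ ^ 2 - L₁ * L₂) *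
      qShifted (q ^ (L₂ - L₁ + 1)) q (2 * L₁ - L₂ + ℓ) *
      ((-1) ^ j * q ^ (j * (j - 1) / 2) * (q ^ (1 - L₂)) ^ j * qBin q (2 * L₂ - L₁) j) := by
    intro j
    rw [finsum_curry _ ((hfin.image Prod.snd).subset fun p hp => ⟨(j, p), hp, rfl⟩)]
    simp only [finsum_affineTerm_right hq0 hq]
    rw [← finsum_mul, ← mul_finsum]
    congr 2
    lift 2 * L₁ - L₂ + ℓ to ℕ using h₁ with a
    exact finsum_qBin hq0 hq (zpow_ne_zero _ hq0) a
  simp only [hin]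
  rw [← mul_finsum]
  congr 1
  lift 2 * L₂ - L₁ to ℕ using h₂ with b
  exact finsum_qBin hq0 hq (zpow_ne_zero _ hq0) b

end AffineSum

/-! ### From pairs `(k, σ)` to lattice points. -/

section Reindexing

variable {K : Type*} [Field K] {q : K}

/-- The summand of the affine sum in the coordinates `w_s = 3 k_s - σ_s`. -/
noncomputable def weightTerm (q : K) (L₁ L₂ ℓ : ℤ) (w : ℤ × ℤ) : K :=
  (charThree (2 * w.2 + w.1 + 6) : K) * q ^ affineExponent w.1 w.2 *
    splitSum q (2 * L₁ - L₂ + ℓ) (2 * L₂ - L₁) (L₂ + 3 + w.1 + w.2) (L₂ - 2 - w.2)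

theorem weightTerm_eq_finsum (q : K) (L₁ L₂ ℓ : ℤ) (w : ℤ × ℤ) :
    weightTerm q L₁ L₂ ℓ w =
      ∑ᶠ j, affineTerm q L₁ L₂ ℓ (L₁ + 1 + w.1 - j) j (L₂ - 2 - w.2 - j) := by
  rw [weightTerm, splitSum, mul_finsum]
  refine finsum_congr fun j => ?_
  rw [affineTerm, splitTerm,
    show L₂ + 3 + w.1 + w.2 + (L₂ - 2 - w.2) - (2 * L₂ - L₁) - j = L₁ + 1 + w.1 - j by ring,
    show L₂ + 3 + w.1 + w.2 + (L₂ - 2 - w.2) - 2 * j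
      = L₁ + 1 + w.1 - j + (2 * L₂ - L₁) - j by ring,
    show L₁ + 1 + w.1 - j + (2 * L₂ - L₁) - j + 1 - 2 * (L₂ - 2 - w.2 - j)
      = 2 * w.2 + w.1 + 6 by ring,
    show L₁ + 1 + w.1 - j + j - L₁ - 1 = w.1 by ring,
    show L₂ - 2 - j - (L₂ - 2 - w.2 - j) = w.2 by ring]
  ring

/-- The change of summation indices from `((w₁, w₂), j)` to `(j, i, r)`. -/
def weightEquiv (L₁ L₂ : ℤ) : (ℤ × ℤ) × ℤ ≃ ℤ × ℤ × ℤ where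
  toFun p := (p.2, L₁ + 1 + p.1.1 - p.2, L₂ - 2 - p.1.2 - p.2)
  invFun p := ((p.2.1 + p.1 - L₁ - 1, L₂ - 2 - p.1 - p.2.2), p.1)
  left_inv p := by ext <;> simp; ring
  right_inv p := by ext <;> simp; ring

theorem finite_support_affineTerm_weightEquiv (q : K) (L₁ L₂ ℓ : ℤ) :
    (fun p : (ℤ × ℤ) × ℤ => affineTerm q L₁ L₂ ℓ (L₁ + 1 + p.1.1 - p.2) p.2
      (L₂ - 2 - p.1.2 - p.2)).support.Finite :=
  ((finite_support_affineTerm q L₁ L₂ ℓ).image (weightEquiv L₁ L₂).symm).subset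
    fun p hp => ⟨weightEquiv L₁ L₂ p, hp, Equiv.symm_apply_apply ..⟩

theorem finite_support_weightTerm (q : K) (L₁ L₂ ℓ : ℤ) :
    (weightTerm q L₁ L₂ ℓ).support.Finite := by
  refine ((finite_support_affineTerm_weightEquiv q L₁ L₂ ℓ).image Prod.fst).subset fun w hw => ?_
  rw [Function.mem_support, weightTerm_eq_finsum] at hw
  obtain ⟨j, hj⟩ := not_forall.1 fun h => hw (finsum_eq_zero_of_forall_eq_zero h)
  exact ⟨(w, j), hj, rfl⟩

theorem finsum_weightTerm (hq0 : q ≠ 0) (hq : ∀ n : ℕ, 0 < n → q ^ n ≠ 1) {L₁ L₂ ℓ : ℤ}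
    (h₁ : 0 ≤ 2 * L₁ - L₂ + ℓ) (h₂ : 0 ≤ 2 * L₂ - L₁) (hℓ : 0 ≤ ℓ) :
    ∑ᶠ w, weightTerm q L₁ L₂ ℓ w = superRHS q L₁ L₂ ℓ := by
  rw [← finsum_affineTerm hq0 hq h₁ h₂ hℓ, ← finsum_comp_equiv (weightEquiv L₁ L₂)]
  simp only [weightTerm_eq_finsum]
  exact (finsum_curry _ (finite_support_affineTerm_weightEquiv q L₁ L₂ ℓ)).symm

/-- The coordinates `(w₁, w₂)`, `w_s = 3 k_s - σ_s`, of a term of the affine sum. -/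
def weightIndex (p : ZeroSumTriple × Equiv.Perm (Fin 3)) : ℤ × ℤ :=
  (3 * p.1.1 0 - (((p.2 0).val : ℤ) + 1), 3 * p.1.1 1 - (((p.2 1).val : ℤ) + 1))

theorem sum_perm_val (σ : Equiv.Perm (Fin 3)) :
    ((σ 0).val : ℤ) + (σ 1).val + (σ 2).val = 3 := by
  revert σ; decide

theorem sign_eq_charThree (σ : Equiv.Perm (Fin 3)) :
    (Equiv.Perm.sign σ : ℤ) = charThree ((σ 2).val - (σ 1).val) := by
  revert σ; decide

/-- The residues of `w₁, w₂` modulo 3 determine `σ₁, σ₂`, hence `k₁, k₂`; the third coordinates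
follow from the two sum conditions. -/
theorem weightIndex_injective : Function.Injective weightIndex := by
  rintro ⟨⟨k, hk⟩, σ⟩ ⟨⟨k', hk'⟩, τ⟩ h
  simp only [weightIndex, Prod.mk.injEq] at h
  have s1 := sum_perm_val σ
  have s2 := sum_perm_val τ
  have e0 : k 0 = k' 0 := by omega
  have e1 : k 1 = k' 1 := by omega
  have e2 : k 2 = k' 2 := by omega
  have hk : k = k' := by
    funext i; fin_cases i <;> assumption
  have hσ : σ = τ := by
    ext i
    fin_cases i <;> simp <;> omega
  subst hk hσ
  rfl

theorem exists_perm_of_injective (s : Fin 3 → Fin 3) (h : s 1 ≠ s 2 ∧ s 0 ≠ s 1 ∧ s 0 ≠ s 2) :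
    ∃ σ : Equiv.Perm (Fin 3), ∀ i, σ i = s i := by
  revert s; decide

theorem mem_range_weightIndex {w : ℤ × ℤ} (h : charThree (2 * w.2 + w.1 + 6) ≠ 0) :
    w ∈ Set.range weightIndex := by
  obtain ⟨a, b⟩ := w
  rw [charThree_ne_zero] at h
  simp only at h
  -- Since `σ_s ≡ -w_s` modulo 3, the zero-based value of `σ` at `s` is the residue of `-w_s - 1`.
  let r : ℤ → Fin 3 := fun x => ⟨((-x - 1) % 3).toNat, by omega⟩
  have hr : ∀ x, ((r x).val : ℤ) = (-x - 1) % 3 := fun x => Int.toNat_of_nonneg (by omega)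
  have hne : ∀ x y, (x - y) % 3 ≠ 0 → r x ≠ r y := by
    intro x y hxy he
    have := congrArg (fun z : Fin 3 => (z.val : ℤ)) he
    simp only [hr] at this
    omega
  obtain ⟨σ, hσ⟩ := exists_perm_of_injective ![r a, r b, r (-6 - a - b)]
    ⟨hne _ _ (by omega), hne _ _ (by omega), hne _ _ (by omega)⟩
  have h0 : ((σ 0).val : ℤ) = (-a - 1) % 3 := by rw [hσ]; exact hr a
  have h1 : ((σ 1).val : ℤ) = (-b - 1) % 3 := by rw [hσ]; exact hr b
  have hs := sum_perm_val σ
  refine ⟨(⟨![(a + ((σ 0).val + 1)) / 3, (b + ((σ 1).val + 1)) / 3,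
    -((a + ((σ 0).val + 1)) / 3) - (b + ((σ 1).val + 1)) / 3], by simp⟩, σ), ?_⟩
  simp only [weightIndex, Prod.mk.injEq, Matrix.cons_val_zero, Matrix.cons_val_one]
  omega

theorem superTerm_eq_weightTerm (hq0 : q ≠ 0) (hq : ∀ n : ℕ, 0 < n → q ^ n ≠ 1) {L₁ L₂ ℓ : ℤ}
    (h₂ : 0 ≤ 2 * L₂ - L₁) (k : ZeroSumTriple) (σ : Equiv.Perm (Fin 3)) :
    superTerm q L₁ L₂ ℓ k σ = weightTerm q L₁ L₂ ℓ (weightIndex (k, σ)) := by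
  obtain ⟨k, hk⟩ := k
  have hs := sum_perm_val σ
  have hk2 : k 2 = -k 0 - k 1 := by omega
  have hs2 : ((σ 2).val : ℤ) = 3 - (σ 0).val - (σ 1).val := by omega
  have hchar : charThree (2 * (weightIndex (⟨k, hk⟩, σ)).2 + (weightIndex (⟨k, hk⟩, σ)).1 + 6) =
      Equiv.Perm.sign σ := by
    rw [sign_eq_charThree, hs2]
    simp only [weightIndex, charThree]
    congr 1
    · congr 1; omega
    · congr 2; omega
  have hexp : doubleExponent k σ / 2 =
      affineExponent (weightIndex (⟨k, hk⟩, σ)).1 (weightIndex (⟨k, hk⟩, σ)).2 := by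
    have h3 := three_mul_affineExponent (w₁ := (weightIndex (⟨k, hk⟩, σ)).1)
      (w₂ := (weightIndex (⟨k, hk⟩, σ)).2) (by rw [hchar]; exact Units.ne_zero _)
    -- This is `∑ σ_s ^ 2 = 14` in zero-based form, with the third value eliminated.
    have hq : ∀ σ : Equiv.Perm (Fin 3), ((σ 0).val : ℤ) ^ 2 + (σ 0).val * (σ 1).val
        + (σ 1).val ^ 2 = 3 * ((σ 0).val + (σ 1).val) - 2 := by decide
    have hd : doubleExponent k σ = 2 *
        affineExponent (weightIndex (⟨k, hk⟩, σ)).1 (weightIndex (⟨k, hk⟩, σ)).2 := by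
      refine mul_left_cancel₀ (three_ne_zero (α := ℤ)) ?_
      rw [mul_left_comm, h3]
      simp only [doubleExponent, Fin.sum_univ_three, hk2, hs2, weightIndex]
      linear_combination -2 * hq σ
    rw [hd, Int.mul_ediv_cancel_left _ two_ne_zero]
  rw [superTerm, weightTerm, hchar, hexp, supernomial_eq_splitSum]
  · congr 1
    obtain ⟨b, hb⟩ := Int.eq_ofNat_of_zero_le h₂
    -- The exchange replaces the first lower entry, which contains `ℓ`, by the third. Then `n + 1 -
    -- 2 r = 2 w₂ + w₁ + 6`, exactly the argument of the character.
    rw [hb, splitSum_swap hq0 hq b]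
    simp only [weightIndex, Matrix.cons_val_zero, Matrix.cons_val_one]
    congr 1
    · linear_combination -2 * hb
    · ring
  · simp
    linear_combination -3 * hk + hs

end Reindexing

/-! ### Assembly of the proposition. -/

theorem proposition5p1 {K : Type*} [Field K] (q : K) (hq0 : q ≠ 0)
    (hq : ∀ n : ℕ, 0 < n → q ^ n ≠ 1) (L₁ L₂ ℓ : ℤ)
    (h₁ : 0 ≤ 2 * L₁ - L₂ + ℓ) (h₂ : 0 ≤ 2 * L₂ - L₁) (hℓ : 0 ≤ ℓ) :
    {p : ZeroSumTriple × Equiv.Perm (Fin 3) | superTerm q L₁ L₂ ℓ p.1 p.2 ≠ 0}.Finite ∧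
    qShifted (q ^ (-ℓ)) q (-L₁) ≠ 0 ∧
    ∑ᶠ k : ZeroSumTriple, ∑ σ : Equiv.Perm (Fin 3), superTerm q L₁ L₂ ℓ k σ
      = superRHS q L₁ L₂ ℓ ∧
    (0 ≤ L₁ → 0 ≤ L₂ →
      superRHS q L₁ L₂ ℓ =
        qShifted q q ℓ * (if L₁ = 0 then 1 else 0) * (if L₂ = 0 then 1 else 0)) := by
  have hterm : ∀ k σ, superTerm q L₁ L₂ ℓ k σ = weightTerm q L₁ L₂ ℓ (weightIndex (k, σ)) :=
    superTerm_eq_weightTerm hq0 hq h₂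
  have hfin : {p : ZeroSumTriple × Equiv.Perm (Fin 3) |
      superTerm q L₁ L₂ ℓ p.1 p.2 ≠ 0}.Finite := by
    simp only [hterm]
    exact (finite_support_weightTerm q L₁ L₂ ℓ).preimage weightIndex_injective.injOn
  refine ⟨hfin, qShifted_zpow_neg_ne_zero hq0 hq hℓ (by omega), ?_, fun hL₁ hL₂ => ?_⟩
  · rw [← finsum_weightTerm hq0 hq h₁ h₂ hℓ]
    calc ∑ᶠ k : ZeroSumTriple, ∑ σ : Equiv.Perm (Fin 3), superTerm q L₁ L₂ ℓ k σ
        = ∑ᶠ p : ZeroSumTriple × Equiv.Perm (Fin 3), superTerm q L₁ L₂ ℓ p.1 p.2 := by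
          rw [finsum_curry _ hfin]
          simp only [finsum_eq_sum_of_fintype]
      _ = ∑ᶠ p, weightTerm q L₁ L₂ ℓ (weightIndex p) := finsum_congr fun p => hterm p.1 p.2
      _ = ∑ᶠ w ∈ Set.range weightIndex, weightTerm q L₁ L₂ ℓ w :=
          (finsum_mem_range weightIndex_injective).symm
      _ = ∑ᶠ w, weightTerm q L₁ L₂ ℓ w := by
          -- Outside the range of `weightIndex` the character, and with it the summand, vanishes.
          rw [finsum_mem_def, Set.indicator_eq_self.2]
          refine fun w hw => mem_range_weightIndex fun h => hw ?_
          simp [weightTerm, h]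
  · rcases hL₂.lt_or_eq with h | rfl
    · rw [superRHS_of_pos hq0 _ _ h, if_neg h.ne', mul_zero]
    · obtain rfl : L₁ = 0 := by omega
      simp [superRHS, qShifted_zero]
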